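/- Write $\mathbb D=\{z\in\mathbb C:|z|<1\}$. For an open set $\Omega\subset\mathbb C^2$, the Bergman projection $\mathbf B_\Omega$ is the orthogonal projection of $L^2(\Omega)$ (Lebesgue measure) onto the subspace of square integrable holomorphic functions on $\Omega$. For an integer $k\ge 0$, $W^k(\Omega)$ is the Sobolev space of the $f\in L^2(\Omega)$ all of whose weak derivatives (in the four real coordinates) of order at most $k$ are in $L^2(\Omega)$, normed by the square root of the sum of the squared $L^2(\Omega)$ norms of these derivatives. $C^\infty(\overline\Omega)$ is the space of the smooth functions $f$ on $\Omega$ such that $$\sup_{z\in\Omega}\left|\frac{\partial^{\alpha+\beta}f}{\partial z^\alpha\partial\bar z^\beta}(z)\right|<\infty\quad\text{for all multi-indices }\alpha,\beta,$$ with the topology given by these suprema as seminorms. A pseudoconvex domain in $\mathbb C^2$ is a nonempty connected open set that has a continuous plurisubharmonic exhaustion function. We say that $\overline\Omega$ has a Stein neighborhood basis if for every open set $U\supset\overline\Omega$ there is a pseudoconvex domain $W$ such that $\overline\Omega\subset\subset W\subset\subset U$, where $A\subset\subset B$ means that the closure of $A$ is a compact subset of $B$. **Theorem.** Let $g$ be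 a nonconstant, nonvanishing, bounded holomorphic function on $\mathbb D$, and let $$\Omega_g=\{(z_1,z_2)\in\mathbb C^2 : z_1\in\mathbb D,\ |z_2|<|g(z_1)|\}.$$ 1. If $\mathbf B_{\Omega_g}$ is bounded from $W^k(\Omega_g)$ to itself for every integer $k\ge 0$, then $\overline{\Omega_g}$ has a Stein neighborhood basis. 2. If $\mathbf B_{\Omega_g}$ maps $C^\infty(\overline{\Omega_g})$ continuously to itself, then $\overline{\Omega_g}$ has a Stein neighborhood basis. -/

import Mathlib

open MeasureTheory Metric
open scoped ContDiff ENNReal NNReal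

noncomputable section

/-! ### Partial derivatives on `ℂ² = ℝ⁴`

`ℂ × ℂ` carries the product topology and the product Lebesgue measure. The four coordinate
directions belong to the real coordinates `(x₁, y₁, x₂, y₂)`, where `z₁ = x₁ + i y₁` and
`z₂ = x₂ + i y₂`. The derivatives in `z₁, z₂` and their conjugates are linear combinations, with
constant coefficients, of the real partial derivatives of the same order. -/

/-- The four real coordinate directions of `ℂ²`. -/
def coordDir : Fin 4 → ℂ × ℂ :=
  ![((1 : ℂ), (0 : ℂ)), (Complex.I, 0), (0, 1), (0, Complex.I)]

/-- The classical partial derivative `∂_{w 0} ⋯ ∂_{w (j-1)} f` of order `j`, at `z`. -/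
def partialDeriv {j : ℕ} (w : Fin j → Fin 4) (f : ℂ × ℂ → ℂ) (z : ℂ × ℂ) : ℂ :=
  iteratedFDeriv ℝ j f z (fun i => coordDir (w i))

/-! ### `L²` Sobolev spaces of integer order -/

/-- `v` is the weak derivative `∂_{w 0} ⋯ ∂_{w (j-1)} f` on the open set `Ω`. -/
def HasWeakDeriv (Ω : Set (ℂ × ℂ)) {j : ℕ} (w : Fin j → Fin 4) (f v : ℂ × ℂ → ℂ) : Prop :=
  LocallyIntegrableOn f Ω volume ∧ LocallyIntegrableOn v Ω volume ∧
    ∀ φ : ℂ × ℂ → ℂ, ContDiff ℝ ∞ φ → HasCompactSupport φ → tsupport φ ⊆ Ω →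
      ∫ z in Ω, f z * partialDeriv w φ z = (-1 : ℂ) ^ j * ∫ z in Ω, v z * φ z

open Classical in
/-- A chosen representative of the weak derivative (unique up to null sets in `Ω`); by convention
`0` if there is none. -/
def weakDeriv (Ω : Set (ℂ × ℂ)) {j : ℕ} (w : Fin j → Fin 4) (f : ℂ × ℂ → ℂ) : ℂ × ℂ → ℂ :=
  if h : ∃ v, HasWeakDeriv Ω w f v then h.choose else 0

/-- `f ∈ W^k(Ω)`: `f` is in `L²(Ω)` and has all weak derivatives of order at most `k`, and they
are in `L²(Ω)`. -/
def MemSobolev (Ω : Set (ℂ × ℂ)) (k : ℕ) (f : ℂ × ℂ → ℂ) : Prop :=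
  MemLp f 2 (volume.restrict Ω) ∧
    ∀ j ≤ k, ∀ w : Fin j → Fin 4,
      ∃ v : ℂ × ℂ → ℂ, HasWeakDeriv Ω w f v ∧ MemLp v 2 (volume.restrict Ω)

/-- The norm of `W^k(Ω)`: the square root of the sum of the squares of the `L²(Ω)` norms of the
weak derivatives of order at most `k`. -/
def sobolevNorm (Ω : Set (ℂ × ℂ)) (k : ℕ) (f : ℂ × ℂ → ℂ) : ℝ≥0∞ :=
  (∑ j ∈ Finset.range (k + 1), ∑ w : Fin j → Fin 4,
    eLpNorm (weakDeriv Ω w f) 2 (volume.restrict Ω) ^ 2) ^ (1 / 2 : ℝ)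

/-! ### The Bergman projection -/

/-- The Hilbert space `L²(Ω)`. -/
abbrev L2 (Ω : Set (ℂ × ℂ)) : Type := Lp ℂ 2 ((volume : Measure (ℂ × ℂ)).restrict Ω)

/-- The Bergman space: the classes in `L²(Ω)` of the functions holomorphic on `Ω`. -/
def bergmanSpace (Ω : Set (ℂ × ℂ)) : Submodule ℂ (L2 Ω) where
  carrier := {f | ∃ F : ℂ × ℂ → ℂ, DifferentiableOn ℂ F Ω ∧ f =ᵐ[volume.restrict Ω] F}
  zero_mem' := ⟨0, differentiableOn_const 0, Lp.coeFn_zero ℂ 2 _⟩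
  add_mem' := by
    rintro f₁ f₂ ⟨F₁, h₁, e₁⟩ ⟨F₂, h₂, e₂⟩
    exact ⟨F₁ + F₂, h₁.add h₂, (Lp.coeFn_add f₁ f₂).trans (e₁.add e₂)⟩
  smul_mem' := by
    rintro c f ⟨F, h, e⟩
    exact ⟨c • F, h.const_smul c, (Lp.coeFn_smul c f).trans (e.const_smul c)⟩

/-- The Bergman projection: the orthogonal projection of `L²(Ω)` onto the Bergman space. For open
`Ω` the Bergman space is closed, so that taking its closure changes nothing; the closure is only
written in order that the projection is defined without a proof of this. -/
def bergmanProjection (Ω : Set (ℂ × ℂ)) : L2 Ω →L[ℂ] L2 Ω :=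
  (bergmanSpace Ω).topologicalClosure.starProjection

/-- The Bergman projection maps `W^k(Ω)` to itself and is bounded there. -/
def BergmanBoundedOnSobolev (Ω : Set (ℂ × ℂ)) (k : ℕ) : Prop :=
  ∃ C : ℝ≥0, ∀ f : L2 Ω, MemSobolev Ω k f →
    MemSobolev Ω k (bergmanProjection Ω f) ∧
      sobolevNorm Ω k (bergmanProjection Ω f) ≤ C * sobolevNorm Ω k f

/-! ### Functions all of whose derivatives are bounded -/

/-- `f ∈ C^∞(closure of Ω)`: `f` is smooth on the open set `Ω` and each of its partial derivatives
(of order `0, 1, 2, …`) is bounded on `Ω`. -/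
def MemSmoothBounded (Ω : Set (ℂ × ℂ)) (f : ℂ × ℂ → ℂ) : Prop :=
  ContDiffOn ℝ ∞ f Ω ∧
    ∀ (j : ℕ) (w : Fin j → Fin 4), ∃ M : ℝ, ∀ z ∈ Ω, ‖partialDeriv w f z‖ ≤ M

/-- The seminorms of `C^∞(closure of Ω)`: the supremum over `Ω` of the partial derivatives of
order at most `k`. -/
def smoothSeminorm (Ω : Set (ℂ × ℂ)) (k : ℕ) (f : ℂ × ℂ → ℂ) : ℝ≥0∞ :=
  ⨆ (j : ℕ) (_ : j ≤ k) (w : Fin j → Fin 4) (z ∈ Ω), ‖partialDeriv w f z‖ₑ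

/-- The Bergman projection maps `C^∞(closure of Ω)` to itself, continuously for the topology given
by the seminorms. Elements of `C^∞(closure of Ω)` are compared with their classes in `L²(Ω)`. -/
def BergmanContinuousOnSmooth (Ω : Set (ℂ × ℂ)) : Prop :=
  (∀ (f : ℂ × ℂ → ℂ) (f₂ : L2 Ω), MemSmoothBounded Ω f → f₂ =ᵐ[volume.restrict Ω] f →
    ∃ F : ℂ × ℂ → ℂ, MemSmoothBounded Ω F ∧ bergmanProjection Ω f₂ =ᵐ[volume.restrict Ω] F) ∧
  ∀ k : ℕ, ∃ (m : ℕ) (C : ℝ≥0), ∀ (f F : ℂ × ℂ → ℂ) (f₂ : L2 Ω),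
    MemSmoothBounded Ω f → MemSmoothBounded Ω F → f₂ =ᵐ[volume.restrict Ω] f →
    bergmanProjection Ω f₂ =ᵐ[volume.restrict Ω] F →
      smoothSeminorm Ω k F ≤ C * smoothSeminorm Ω m f

/-! ### Pseudoconvex domains and Stein neighborhood bases -/

/-- `u` is a continuous plurisubharmonic function on the open set `W`: on each closed disc
`{a + ζ b : |ζ| ≤ 1}` in a complex line that lies in `W`, the value at the centre is at most the
mean over the boundary circle. -/
def IsContPlurisubharmonicOn (u : ℂ × ℂ → ℝ) (W : Set (ℂ × ℂ)) : Prop :=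
  ContinuousOn u W ∧
    ∀ a b : ℂ × ℂ, (∀ ζ : ℂ, ‖ζ‖ ≤ 1 → a + ζ • b ∈ W) →
      u a ≤ Real.circleAverage (fun ζ : ℂ => u (a + ζ • b)) 0 1

/-- A pseudoconvex domain in `ℂ²`: a nonempty connected open set with a continuous
plurisubharmonic exhaustion function. -/
def IsPseudoconvexDomain (W : Set (ℂ × ℂ)) : Prop :=
  IsOpen W ∧ IsConnected W ∧
    ∃ u : ℂ × ℂ → ℝ, IsContPlurisubharmonicOn u W ∧ ∀ c : ℝ, IsCompact {z ∈ W | u z ≤ c}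

/-- `A ⊂⊂ B`: the closure of `A` is a compact subset of `B`. -/
def CompactlyContained (A B : Set (ℂ × ℂ)) : Prop :=
  IsCompact (closure A) ∧ closure A ⊆ B

/-- The closed set `K` has a Stein neighborhood basis. -/
def HasSteinNeighborhoodBasis (K : Set (ℂ × ℂ)) : Prop :=
  ∀ U : Set (ℂ × ℂ), IsOpen U → K ⊆ U →
    ∃ W : Set (ℂ × ℂ), IsPseudoconvexDomain W ∧ CompactlyContained K W ∧ CompactlyContained W U

/-- The complete Hartogs domain `{(z₁, z₂) : |z₁| < 1, |z₂| < |g(z₁)|}`. -/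
def hartogsDomain (g : ℂ → ℂ) : Set (ℂ × ℂ) :=
  {z | z.1 ∈ ball (0 : ℂ) 1 ∧ ‖z.2‖ < ‖g z.1‖}

end

/-!
Pulling back by `(z, t) ↦ (z, t g(z))`, whose real Jacobian is `|g(z)|²`, turns integrals over the
Hartogs domain into integrals over the bidisc. Let `ρ` be a radial cutoff on the disc with mean `1`.
The mean value property, applied in `z`, shows that `(ρ(|z₁|) - 1) z₂ / g(z₁)²` is orthogonal to all
square integrable holomorphic functions, so the Bergman projection of the smooth function
`ρ(|z₁|) z₂ / g(z₁)²` is `z₂ / g(z₁)²`. If the projection is regular, then `g (1 / g²)‴` and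
`g (1 / g²)` are square integrable on the disc, so their product `(1 / g²)‴` is integrable. Its
Taylor coefficients therefore grow at most linearly, those of `1 / g²` are absolutely summable, and
`|g|` extends to a positive continuous function on the closed disc. Slight dilations of the Hartogs
domain then form a Stein neighborhood basis.
-/

open Set Filter Topology

section Pseudoconvexity

lemma map_le_circleAverage_of_convexOn {E : Type*} [NormedAddCommGroup E] [NormedSpace ℂ E]
    [CompleteSpace E] {φ : E → ℝ} {s : Set E} {f : ℂ → E} {c : ℂ} {R : ℝ}
    (hφ : ConvexOn ℝ s φ) (hφc : ContinuousOn φ s) (hs : IsClosed s)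
    (hf : DiffContOnCl ℂ f (ball c |R|)) (hfs : MapsTo f (sphere c |R|) s) :
    φ (f c) ≤ Real.circleAverage (φ ∘ f) c R := by
  have hfc : ContinuousOn f (sphere c |R|) :=
    hf.continuousOn_ball.mono sphere_subset_closedBall
  rw [← hf.circleAverage, Real.circleAverage_eq_intervalAverage,
    Real.circleAverage_eq_intervalAverage]
  refine hφ.map_set_average_le hφc hs ?_ ?_ ?_ ?_ ?_
  · simp [Real.pi_pos.le, Real.pi_pos]
  · simp [ENNReal.mul_eq_top]
  · exact .of_forall fun θ => hfs (circleMap_mem_sphere' c R θ)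
  · exact hfc.circleIntegrable'.def'
  · exact (hφc.comp hfc hfs).circleIntegrable'.def'

lemma convexOn_inv_one_sub_norm {E : Type*} [SeminormedAddCommGroup E] [NormedSpace ℝ E] :
    ConvexOn ℝ (ball (0 : E) 1) fun x => (1 - ‖x‖)⁻¹ := by
  refine ⟨convex_ball 0 1, fun x hx y hy a b ha hb hab => ?_⟩
  rw [mem_ball_zero_iff, ← sub_pos] at hx hy
  have hpos : 0 < a * (1 - ‖x‖) + b * (1 - ‖y‖) := (convex_Ioi (0 : ℝ)) hx hy ha hb hab
  have hnorm : ‖a • x + b • y‖ ≤ a * ‖x‖ + b * ‖y‖ :=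
    convexOn_univ_norm.2 (mem_univ x) (mem_univ y) ha hb hab
  calc (1 - ‖a • x + b • y‖)⁻¹ ≤ (a * (1 - ‖x‖) + b * (1 - ‖y‖))⁻¹ := by
        gcongr
        linarith
    _ ≤ a * (1 - ‖x‖)⁻¹ + b * (1 - ‖y‖)⁻¹ := by
        simpa using (convexOn_zpow (𝕜 := ℝ) (-1)).2 hx hy ha hb hab

lemma continuousOn_inv_one_sub_norm {E : Type*} [SeminormedAddCommGroup E] :
    ContinuousOn (fun x : E => (1 - ‖x‖)⁻¹) (ball 0 1) :=
  (continuousOn_const.sub continuousOn_id.norm).inv₀ fun _ hx =>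
    (sub_pos.2 (mem_ball_zero_iff.1 hx)).ne'

lemma isContPlurisubharmonicOn_inv_one_sub_norm {E : Type*} [NormedAddCommGroup E]
    [NormedSpace ℂ E] [CompleteSpace E] {W : Set (ℂ × ℂ)} {T : ℂ × ℂ → E}
    (hT : DifferentiableOn ℂ T W) (hTW : MapsTo T W (ball 0 1)) :
    IsContPlurisubharmonicOn (fun z => (1 - ‖T z‖)⁻¹) W := by
  refine ⟨continuousOn_inv_one_sub_norm.comp hT.continuousOn hTW, fun a b hab => ?_⟩
  set f : ℂ → E := fun ζ => T (a + ζ • b)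
  have hf : DifferentiableOn ℂ f (closedBall 0 1) :=
    hT.comp (f := fun ζ : ℂ => a + ζ • b) (by fun_prop)
      fun ζ hζ => hab ζ (mem_closedBall_zero_iff.1 hζ)
  obtain ⟨ζ₀, hζ₀, hmax⟩ := (isCompact_closedBall (0 : ℂ) 1).exists_isMaxOn
    (nonempty_closedBall.2 zero_le_one) hf.continuousOn.norm
  have hball : closedBall (0 : E) ‖f ζ₀‖ ⊆ ball 0 1 := closedBall_subset_ball <|
    mem_ball_zero_iff.1 (hTW (hab ζ₀ (mem_closedBall_zero_iff.1 hζ₀)))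
  have hmean : (1 - ‖f 0‖)⁻¹ ≤ Real.circleAverage ((fun x => (1 - ‖x‖)⁻¹) ∘ f) 0 1 := by
    refine map_le_circleAverage_of_convexOn
      (convexOn_inv_one_sub_norm.subset hball (convex_closedBall 0 _))
      (continuousOn_inv_one_sub_norm.mono hball) isClosed_closedBall ?_ fun ζ hζ => ?_
    · rw [abs_one]
      exact hf.diffContOnCl_ball subset_rfl
    · rw [abs_one] at hζ
      exact mem_closedBall_zero_iff.2 (hmax (sphere_subset_closedBall hζ))
  simpa only [f, zero_smul, add_zero, Function.comp_def] using hmean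

lemma isCompact_inv_one_sub_norm_le {E : Type*} [SeminormedAddCommGroup E] [ProperSpace E] (c : ℝ) :
    IsCompact {x ∈ ball (0 : E) 1 | (1 - ‖x‖)⁻¹ ≤ c} := by
  rcases le_or_gt c 0 with hc | hc
  · convert! isCompact_empty
    refine eq_empty_of_forall_notMem fun x ⟨hx, hle⟩ => ?_
    exact (hle.trans hc).not_gt (inv_pos.2 (sub_pos.2 (mem_ball_zero_iff.1 hx)))
  · convert! isCompact_closedBall (0 : E) (1 - c⁻¹)
    ext x
    rw [mem_closedBall_zero_iff]
    constructor
    · rintro ⟨hx, hle⟩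
      rw [mem_ball_zero_iff] at hx
      linarith [(inv_le_comm₀ (sub_pos.2 hx) hc).1 hle]
    · intro hx
      have hx1 : ‖x‖ < 1 := by linarith [inv_pos.2 hc]
      exact ⟨mem_ball_zero_iff.2 hx1, (inv_le_comm₀ (sub_pos.2 hx1) hc).2 (by linarith)⟩

theorem isPseudoconvexDomain_image_ball {Φ T : ℂ × ℂ → ℂ × ℂ} (hopen : IsOpen (Φ '' ball 0 1))
    (hΦ : ContinuousOn Φ (ball 0 1)) (hT : DifferentiableOn ℂ T (Φ '' ball 0 1))
    (hinv : LeftInvOn T Φ (ball 0 1)) : IsPseudoconvexDomain (Φ '' ball 0 1) := by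
  refine ⟨hopen, ((convex_ball _ _).isConnected (nonempty_ball.2 one_pos)).image _ hΦ,
    fun z => (1 - ‖T z‖)⁻¹, ?_, fun c => ?_⟩
  · exact isContPlurisubharmonicOn_inv_one_sub_norm hT
      (by rintro _ ⟨p, hp, rfl⟩; rwa [hinv hp])
  · have hsublevel : {z ∈ Φ '' ball 0 1 | (1 - ‖T z‖)⁻¹ ≤ c} =
        Φ '' {p ∈ ball 0 1 | (1 - ‖p‖)⁻¹ ≤ c} := by
      ext z
      constructor
      · rintro ⟨⟨p, hp, rfl⟩, hle⟩
        exact ⟨p, ⟨hp, by rwa [hinv hp] at hle⟩, rfl⟩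
      · rintro ⟨p, ⟨hp, hle⟩, rfl⟩
        exact ⟨⟨p, hp, rfl⟩, by rwa [hinv hp]⟩
    rw [hsublevel]
    exact (isCompact_inv_one_sub_norm_le c).image_of_continuousOn (hΦ.mono (sep_subset _ _))

end Pseudoconvexity

section HartogsDomain

variable {g : ℂ → ℂ}

lemma isOpen_hartogsDomain (hg : ContinuousOn g (ball 0 1)) : IsOpen (hartogsDomain g) := by
  have hcont : ContinuousOn (fun z : ℂ × ℂ => ‖g z.1‖ - ‖z.2‖) (Prod.fst ⁻¹' ball 0 1) :=
    (hg.comp continuousOn_fst fun _ hz => hz).norm.sub continuousOn_snd.norm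
  convert hcont.isOpen_inter_preimage (isOpen_ball.preimage continuous_fst) (isOpen_Ioi (a := 0))
    using 1
  ext z
  simp [hartogsDomain]

lemma isBounded_hartogsDomain {M : ℝ} (hM : ∀ z ∈ ball (0 : ℂ) 1, ‖g z‖ ≤ M) :
    Bornology.IsBounded (hartogsDomain g) :=
  (isBounded_ball.prod (isBounded_closedBall (x := (0 : ℂ)) (r := M))).subset fun z hz =>
    ⟨hz.1, mem_closedBall_zero_iff.2 (hz.2.le.trans (hM z.1 hz.1))⟩

lemma mem_ball_zero_prod_iff {E F : Type*} [SeminormedAddCommGroup E] [SeminormedAddCommGroup F]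
    {p : E × F} {r : ℝ} : p ∈ ball (0 : E × F) r ↔ p.1 ∈ ball 0 r ∧ p.2 ∈ ball 0 r := by
  rw [← Prod.mk_zero_zero, ← ball_prod_same, mem_prod]

/-- The parametrization `(z, t) ↦ (z, t g(z))` of the Hartogs domain of a nonvanishing `g` by the
bidisc, which is the unit ball of `ℂ × ℂ`. -/
def hartogsParam (g : ℂ → ℂ) (p : ℂ × ℂ) : ℂ × ℂ := (p.1, g p.1 * p.2)

lemma hartogsParam_image_ball (hg0 : ∀ z ∈ ball (0 : ℂ) 1, g z ≠ 0) :
    hartogsParam g '' ball 0 1 = hartogsDomain g := by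
  ext z
  constructor
  · rintro ⟨p, hp, rfl⟩
    rw [mem_ball_zero_prod_iff] at hp
    refine ⟨hp.1, ?_⟩
    change ‖g p.1 * p.2‖ < ‖g p.1‖
    rw [norm_mul]
    exact mul_lt_of_lt_one_right (norm_pos_iff.2 (hg0 _ hp.1)) (mem_ball_zero_iff.1 hp.2)
  · intro hz
    refine ⟨(z.1, z.2 / g z.1), ?_, Prod.ext rfl (mul_div_cancel₀ _ (hg0 _ hz.1))⟩
    refine mem_ball_zero_prod_iff.2 ⟨hz.1, mem_ball_zero_iff.2 ?_⟩
    rw [norm_div]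
    exact (div_lt_one (norm_pos_iff.2 (hg0 _ hz.1))).2 hz.2

/-- The linear map `(z₁, z₂) ↦ (r z₁, s z₂)`. -/
def dilate (r s : ℝ) (z : ℂ × ℂ) : ℂ × ℂ := (r * z.1, s * z.2)

lemma continuous_dilate (r s : ℝ) : Continuous (dilate r s) := by
  unfold dilate
  fun_prop

lemma dilate_inv_dilate {r s : ℝ} (hr : r ≠ 0) (hs : s ≠ 0) :
    Function.LeftInverse (dilate r⁻¹ s⁻¹) (dilate r s) := fun z => by
  simp [dilate, hr, hs]

lemma dilate_dilate_inv {r s : ℝ} (hr : r ≠ 0) (hs : s ≠ 0) :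
    Function.RightInverse (dilate r⁻¹ s⁻¹) (dilate r s) := fun z => by
  simp [dilate, hr, hs]

lemma image_dilate_eq_preimage {r s : ℝ} (hr : r ≠ 0) (hs : s ≠ 0) (A : Set (ℂ × ℂ)) :
    dilate r s '' A = dilate r⁻¹ s⁻¹ ⁻¹' A :=
  congrFun (image_eq_preimage_of_inverse (dilate_inv_dilate hr hs) (dilate_dilate_inv hr hs)) A

lemma isPseudoconvexDomain_dilate_hartogsDomain (hg : DifferentiableOn ℂ g (ball 0 1))
    (hg0 : ∀ z ∈ ball (0 : ℂ) 1, g z ≠ 0) {r s : ℝ} (hr : r ≠ 0) (hs : s ≠ 0) :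
    IsPseudoconvexDomain (dilate r s '' hartogsDomain g) := by
  have himage : dilate r s '' hartogsDomain g = (dilate r s ∘ hartogsParam g) '' ball 0 1 := by
    rw [image_comp, hartogsParam_image_ball hg0]
  set T : ℂ × ℂ → ℂ × ℂ := fun z => (z.1, (g z.1)⁻¹ * z.2)
  have hT : DifferentiableOn ℂ T (hartogsDomain g) :=
    differentiableOn_fst.prodMk (((hg.inv hg0).comp differentiableOn_fst fun z hz => hz.1).mul
      differentiableOn_snd)
  have hparam : ContinuousOn (hartogsParam g) (ball 0 1) :=
    continuousOn_fst.prodMk <| (hg.continuousOn.comp continuousOn_fst fun p hp =>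
      (mem_ball_zero_prod_iff.1 hp).1).mul continuousOn_snd
  rw [himage]
  refine isPseudoconvexDomain_image_ball (T := T ∘ dilate r⁻¹ s⁻¹) ?_ ?_ ?_ ?_
  · rw [← himage, image_dilate_eq_preimage hr hs]
    exact (isOpen_hartogsDomain hg.continuousOn).preimage (continuous_dilate _ _)
  · exact (continuous_dilate r s).comp_continuousOn hparam
  · rw [← himage]
    refine hT.comp (t := hartogsDomain g) ?_ ?_
    · unfold dilate
      fun_prop
    · rw [image_dilate_eq_preimage hr hs]
      exact fun z hz => hz
  · intro p hp
    simp only [Function.comp_apply, dilate_inv_dilate hr hs _]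
    exact Prod.ext rfl (inv_mul_cancel_left₀ (hg0 _ (mem_ball_zero_prod_iff.1 hp).1) _)

lemma closure_hartogsDomain_subset {ψ : ℂ → ℝ} (hψ : Continuous ψ)
    (hψg : ∀ z ∈ ball (0 : ℂ) 1, ψ z = ‖g z‖) :
    closure (hartogsDomain g) ⊆ {z | z.1 ∈ closedBall 0 1 ∧ ‖z.2‖ ≤ ψ z.1} :=
  closure_minimal (fun _ hz => ⟨ball_subset_closedBall hz.1, (hz.2.trans_eq (hψg _ hz.1).symm).le⟩)
    ((isClosed_closedBall.preimage continuous_fst).inter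
      (isClosed_le continuous_snd.norm (hψ.comp continuous_fst)))

lemma subset_dilate_hartogsDomain {ψ : ℂ → ℝ} (hψg : ∀ z ∈ ball (0 : ℂ) 1, ψ z = ‖g z‖) {r s : ℝ}
    (hr : 1 < r) (hs : 0 < s) (hψ : ∀ z ∈ closedBall (0 : ℂ) 1, ψ z < s * ψ ((r⁻¹ : ℝ) * z)) :
    {z : ℂ × ℂ | z.1 ∈ closedBall 0 1 ∧ ‖z.2‖ ≤ ψ z.1} ⊆ dilate r s '' hartogsDomain g := by
  rintro z ⟨hz1, hz2⟩
  have hr0 : 0 < r := one_pos.trans hr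
  rw [image_dilate_eq_preimage hr0.ne' hs.ne']
  have hball : ((r⁻¹ : ℝ) : ℂ) * z.1 ∈ ball (0 : ℂ) 1 := by
    rw [mem_ball_zero_iff, norm_mul, Complex.norm_real, Real.norm_of_nonneg (by positivity),
      ← div_eq_inv_mul, div_lt_one hr0]
    exact (mem_closedBall_zero_iff.1 hz1).trans_lt hr
  refine ⟨hball, ?_⟩
  change ‖((s⁻¹ : ℝ) : ℂ) * z.2‖ < ‖g (((r⁻¹ : ℝ) : ℂ) * z.1)‖
  rw [norm_mul, Complex.norm_real, Real.norm_of_nonneg (by positivity), ← div_eq_inv_mul,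
    div_lt_iff₀' hs, ← hψg _ hball]
  exact hz2.trans_lt (hψ _ hz1)

lemma eventually_dilate_image_subset {K U : Set (ℂ × ℂ)} (hK : IsCompact K) (hU : IsOpen U)
    (hKU : K ⊆ U) : ∀ᶠ s : ℝ in 𝓝 1, ∀ᶠ r : ℝ in 𝓝 1, dilate r s '' K ⊆ U := by
  have hcont : Continuous fun x : (ℝ × ℝ) × ℂ × ℂ => dilate x.1.2 x.1.1 x.2 := by
    unfold dilate
    fun_prop
  simp only [image_subset_iff]
  refine Eventually.curry_nhds (hK.eventually_forall_of_forall_eventually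
    (P := fun q : ℝ × ℝ => fun z => dilate q.2 q.1 z ∈ U) fun z hz => ?_)
  exact hcont.continuousAt.eventually_mem (hU.mem_nhds (by simpa [dilate] using hKU hz))

lemma eventually_lt_mul_comp_inv_mul {ψ : ℂ → ℝ} (hψ : Continuous ψ)
    (hψ0 : ∀ z ∈ closedBall (0 : ℂ) 1, 0 < ψ z) {s : ℝ} (hs : 1 < s) :
    ∀ᶠ r : ℝ in 𝓝 1, ∀ z ∈ closedBall (0 : ℂ) 1, ψ z < s * ψ ((r⁻¹ : ℝ) * z) := by
  refine (isCompact_closedBall 0 1).eventually_forall_of_forall_eventually fun z hz => ?_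
  have hscale : ContinuousAt (fun x : ℝ × ℂ => ((x.1⁻¹ : ℝ) : ℂ) * x.2) (1, z) :=
    (Complex.continuous_ofReal.continuousAt.comp
      (continuousAt_fst.inv₀ one_ne_zero)).mul continuousAt_snd
  refine ContinuousAt.eventually_lt (hψ.continuousAt.comp continuousAt_snd)
    (continuousAt_const.mul (hψ.continuousAt.comp hscale)) ?_
  simpa using lt_mul_of_one_lt_left (hψ0 z hz) hs

/-- The two scales are chosen one after the other: `s > 1` makes room above the graph of `ψ`, and
then `r > 1` is taken so close to `1` that `ψ (z / r)` has not left that room. -/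
theorem hasSteinNeighborhoodBasis_closure_hartogsDomain {ψ : ℂ → ℝ}
    (hg : DifferentiableOn ℂ g (ball 0 1)) (hg0 : ∀ z ∈ ball (0 : ℂ) 1, g z ≠ 0)
    (hψ : Continuous ψ) (hψ0 : ∀ z ∈ closedBall (0 : ℂ) 1, 0 < ψ z)
    (hψg : ∀ z ∈ ball (0 : ℂ) 1, ψ z = ‖g z‖) :
    HasSteinNeighborhoodBasis (closure (hartogsDomain g)) := by
  intro U hU hKU
  obtain ⟨M, hM⟩ := (isCompact_closedBall (0 : ℂ) 1).exists_bound_of_continuousOn hψ.continuousOn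
  have hK : IsCompact (closure (hartogsDomain g)) :=
    (isBounded_hartogsDomain (M := M) fun z hz => by
      rw [← hψg z hz]
      exact (le_abs_self _).trans (hM z (ball_subset_closedBall hz))).isCompact_closure
  obtain ⟨s, hsU, hs⟩ := (((eventually_dilate_image_subset hK hU hKU).filter_mono
    nhdsWithin_le_nhds).and self_mem_nhdsWithin).exists (f := 𝓝[>] 1)
  obtain ⟨r, ⟨hrU, hrψ⟩, hr⟩ := (((hsU.and (eventually_lt_mul_comp_inv_mul hψ hψ0 hs)).filter_mono
    nhdsWithin_le_nhds).and self_mem_nhdsWithin).exists (f := 𝓝[>] 1)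
  have hr0 : r ≠ 0 := (one_pos.trans hr).ne'
  have hs0 : 0 < s := one_pos.trans hs
  have hclosure : closure (dilate r s '' hartogsDomain g) ⊆
      dilate r s '' closure (hartogsDomain g) :=
    closure_minimal (image_mono subset_closure) (hK.image (continuous_dilate r s)).isClosed
  refine ⟨dilate r s '' hartogsDomain g,
    isPseudoconvexDomain_dilate_hartogsDomain hg hg0 hr0 hs0.ne', ⟨?_, ?_⟩, ?_, ?_⟩
  · rwa [closure_closure]
  · rw [closure_closure]
    exact (closure_hartogsDomain_subset hψ hψg).trans (subset_dilate_hartogsDomain hψg hr hs0 hrψ)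
  · exact (hK.image (continuous_dilate r s)).of_isClosed_subset isClosed_closure hclosure
  · exact hclosure.trans hrU

end HartogsDomain

section Rotation

variable {μ : Measure ℂ} [SFinite μ] [SMulInvariantMeasure Circle ℂ μ]
  {E : Type*} [NormedAddCommGroup E] {F : ℂ → E}

instance smulInvariantMeasure_circle_restrict_ball (R : ℝ) :
    SMulInvariantMeasure Circle ℂ (volume.restrict (ball (0 : ℂ) R)) := by
  refine (smulInvariantMeasure_tfae Circle _).out 6 0 |>.1 fun u => ?_
  have hball : rotation u ⁻¹' ball 0 R = ball 0 R := by
    rw [LinearIsometryEquiv.preimage_ball, map_zero]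
  have hrot := (rotation u).measurePreserving.restrict_preimage (s := ball 0 R) measurableSet_ball
  rwa [hball] at hrot

lemma circleAverage_zero_norm_eq [NormedSpace ℝ E] (F : ℂ → E) (z : ℂ) :
    Real.circleAverage F 0 ‖z‖ = (2 * Real.pi)⁻¹ • ∫ θ in 0..2 * Real.pi, F (Circle.exp θ • z) := by
  have hrot (θ : ℝ) : circleMap 0 ‖z‖ (θ + z.arg) = Circle.exp θ • z := by
    rw [circleMap_zero, Circle.smul_def, Circle.coe_exp, smul_eq_mul]
    nth_rw 3 [← Complex.norm_mul_exp_arg_mul_I z]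
    rw [Complex.ofReal_add, add_mul, Complex.exp_add]
    ring
  rw [Real.circleAverage_eq_integral_add z.arg]
  simp only [hrot]

lemma integrable_comp_rotation (hF : Integrable F μ) :
    Integrable (fun p : ℝ × ℂ => F (Circle.exp p.1 • p.2))
      ((volume.restrict (Ioc 0 (2 * Real.pi))).prod μ) := by
  have hmeas : Continuous fun p : ℝ × ℂ => Circle.exp p.1 • p.2 := by fun_prop
  have hskew : MeasurePreserving (fun p : ℝ × ℂ => (p.1, Circle.exp p.1 • p.2))
      ((volume.restrict (Ioc 0 (2 * Real.pi))).prod μ)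
      ((volume.restrict (Ioc 0 (2 * Real.pi))).prod μ) :=
    (MeasurePreserving.id _).skew_product hmeas.measurable
      (.of_forall fun θ => (measurePreserving_smul (Circle.exp θ) μ).map_eq)
  exact hskew.integrable_comp_of_integrable (hF.comp_snd _)

lemma integrable_circleAverage_zero_norm [NormedSpace ℝ E] (hF : Integrable F μ) :
    Integrable (fun z => Real.circleAverage F 0 ‖z‖) μ := by
  simp only [circleAverage_zero_norm_eq, intervalIntegral.integral_of_le Real.two_pi_pos.le]
  exact (integrable_comp_rotation hF).integral_prod_right.smul _

theorem integral_circleAverage_zero_norm [NormedSpace ℝ E] [CompleteSpace E] (hF : Integrable F μ) :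
    ∫ z, Real.circleAverage F 0 ‖z‖ ∂μ = ∫ z, F z ∂μ := by
  simp only [circleAverage_zero_norm_eq, intervalIntegral.integral_of_le Real.two_pi_pos.le]
  rw [integral_smul, ← integral_integral_swap (integrable_comp_rotation hF)]
  have hrot (θ : ℝ) : ∫ z, F (Circle.exp θ • z) ∂μ = ∫ z, F z ∂μ :=
    integral_smul_eq_self F
  simp only [hrot]
  rw [setIntegral_const, Real.volume_real_Ioc_of_le Real.two_pi_pos.le, sub_zero,
    inv_smul_smul₀ Real.two_pi_pos.ne']

end Rotation

section Disc

lemma differentiableOn_iteratedDeriv {U : Set ℂ} (hU : IsOpen U) {u : ℂ → ℂ}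
    (hu : DifferentiableOn ℂ u U) (n : ℕ) : DifferentiableOn ℂ (iteratedDeriv n u) U := by
  induction n with
  | zero => rwa [iteratedDeriv_zero]
  | succ n ih =>
    rw [iteratedDeriv_succ]
    exact ih.deriv hU

lemma setIntegral_radial_mul {R : ℝ} {ρ : ℝ → ℂ} {H : ℂ → ℂ} (hH : DifferentiableOn ℂ H (ball 0 R))
    (hi : IntegrableOn (fun z => ρ ‖z‖ * H z) (ball 0 R)) :
    ∫ z in ball (0 : ℂ) R, ρ ‖z‖ * H z = (∫ z in ball (0 : ℂ) R, ρ ‖z‖) * H 0 := by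
  rw [← integral_circleAverage_zero_norm hi, ← integral_mul_const]
  refine setIntegral_congr_fun measurableSet_ball fun z hz => ?_
  have hmean : Real.circleAverage H 0 ‖z‖ = H 0 :=
    (hH.diffContOnCl_ball (by
      rw [abs_norm]
      exact closedBall_subset_ball (mem_ball_zero_iff.1 hz))).circleAverage
  calc Real.circleAverage (fun w => ρ ‖w‖ * H w) 0 ‖z‖
      = Real.circleAverage (ρ ‖z‖ • H) 0 ‖z‖ :=
        Real.circleAverage_congr_sphere fun w hw => by
          rw [mem_sphere_zero_iff_norm, abs_norm] at hw
          simp [hw]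
    _ = ρ ‖z‖ * H 0 := by rw [Real.circleAverage_smul, hmean, smul_eq_mul]

lemma norm_iteratedDeriv_div_factorial_mul_pow_le_circleAverage {q : ℂ → ℂ} {r : ℝ} (hr : 0 < r)
    (hq : DifferentiableOn ℂ q (closedBall 0 r)) (n : ℕ) :
    ‖iteratedDeriv n q 0‖ / n.factorial * r ^ n ≤ Real.circleAverage (fun z => ‖q z‖) 0 r := by
  have hseries : HasFPowerSeriesOnBall q (cauchyPowerSeries q 0 r) 0 _ :=
    DifferentiableOn.hasFPowerSeriesOnBall (R := ⟨r, hr.le⟩) hq hr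
  have hcoeff : iteratedDeriv n q 0 = n.factorial * cauchyPowerSeries q 0 r n fun _ => 1 := by
    simpa [iteratedDeriv_eq_iteratedFDeriv] using (hseries.factorial_smul 1 n).symm
  calc ‖iteratedDeriv n q 0‖ / n.factorial * r ^ n
      = ‖cauchyPowerSeries q 0 r n fun _ => 1‖ * r ^ n := by
        rw [hcoeff, norm_mul, Complex.norm_natCast, mul_div_cancel_left₀ _ (by positivity)]
    _ ≤ ‖cauchyPowerSeries q 0 r n‖ * r ^ n := by
        gcongr
        simp
    _ ≤ (2 * Real.pi)⁻¹ * (∫ θ in 0..2 * Real.pi, ‖q (circleMap 0 r θ)‖) * |r|⁻¹ ^ n * r ^ n := by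
        gcongr
        exact norm_cauchyPowerSeries_le q 0 r n
    _ = Real.circleAverage (fun z => ‖q z‖) 0 r := by
        rw [abs_of_pos hr, inv_pow, inv_mul_cancel_right₀ (by positivity), Real.circleAverage_def,
          smul_eq_mul]

lemma setIntegral_ball_norm_pow (n : ℕ) :
    ∫ z in ball (0 : ℂ) 1, ‖z‖ ^ n = 2 * Real.pi / (n + 2) := by
  have hradial : ∀ z : ℂ, (ball (0 : ℂ) 1).indicator (fun z => ‖z‖ ^ n) z =
      (Iio (1 : ℝ)).indicator (fun r => r ^ n) ‖z‖ := fun z => by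
    simp [indicator]
  have hweight : ∀ y : ℝ,
      y ^ (Module.finrank ℝ ℂ - 1) • (Iio (1 : ℝ)).indicator (fun r => r ^ n) y =
        (Iio (1 : ℝ)).indicator (fun r => r ^ (n + 1)) y := fun y => by
    by_cases hy : y < 1 <;> simp [hy, Complex.finrank_real_complex, pow_succ']
  rw [← integral_indicator measurableSet_ball]
  simp only [hradial]
  rw [integral_fun_norm_addHaar volume ((Iio (1 : ℝ)).indicator fun r => r ^ n)]
  simp only [hweight]
  rw [setIntegral_indicator measurableSet_Iio, Ioi_inter_Iio, ← integral_Ioc_eq_integral_Ioo,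
    ← intervalIntegral.integral_of_le zero_le_one, integral_pow]
  simp only [Complex.finrank_real_complex, Measure.real, Complex.volume_ball]
  simp only [ENNReal.ofReal_one, one_pow, one_mul, ENNReal.coe_toReal, NNReal.coe_real_pi, ne_eq,
    Nat.add_eq_zero_iff, one_ne_zero, and_false, and_self, not_false_eq_true, zero_pow, sub_zero,
    Nat.cast_add, Nat.cast_one, one_div, smul_eq_mul, nsmul_eq_mul, Nat.cast_ofNat]
  field_simp
  ring

lemma norm_iteratedDeriv_div_factorial_le_setIntegral {q : ℂ → ℂ}
    (hq : DifferentiableOn ℂ q (ball 0 1)) (hi : IntegrableOn q (ball 0 1)) (n : ℕ) :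
    ‖iteratedDeriv n q 0‖ / n.factorial ≤
      (n + 2) / (2 * Real.pi) * ∫ z in ball (0 : ℂ) 1, ‖q z‖ := by
  have hcircle : ∀ᵐ z ∂volume.restrict (ball (0 : ℂ) 1),
      ‖iteratedDeriv n q 0‖ / n.factorial * ‖z‖ ^ n ≤
        Real.circleAverage (fun w => ‖q w‖) 0 ‖z‖ := by
    filter_upwards [ae_restrict_mem measurableSet_ball, Measure.ae_ne _ 0] with z hz hz0
    exact norm_iteratedDeriv_div_factorial_mul_pow_le_circleAverage (norm_pos_iff.2 hz0)
      (hq.mono (closedBall_subset_ball (mem_ball_zero_iff.1 hz))) n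
  have hpow : IntegrableOn (fun z : ℂ => ‖z‖ ^ n) (ball 0 1) :=
    (Continuous.continuousOn (by fun_prop)).integrableOn_compact (isCompact_closedBall 0 1)
      |>.mono_set ball_subset_closedBall
  have hint : ‖iteratedDeriv n q 0‖ / n.factorial * (2 * Real.pi / (n + 2)) ≤
      ∫ z in ball (0 : ℂ) 1, ‖q z‖ := by
    rw [← setIntegral_ball_norm_pow, ← integral_const_mul,
      ← integral_circleAverage_zero_norm hi.norm]
    exact integral_mono_ae (hpow.const_mul _) (integrable_circleAverage_zero_norm hi.norm) hcircle
  rwa [← inv_div (2 * Real.pi), inv_mul_eq_div, le_div_iff₀ (by positivity)]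

lemma summable_norm_iteratedDeriv_div_factorial {u : ℂ → ℂ} (hu : DifferentiableOn ℂ u (ball 0 1))
    (hi : IntegrableOn (iteratedDeriv 3 u) (ball 0 1)) :
    Summable fun n : ℕ => ‖iteratedDeriv n u 0 / n.factorial‖ := by
  set C : ℝ := (2 * Real.pi)⁻¹ * ∫ z in ball (0 : ℂ) 1, ‖iteratedDeriv 3 u z‖
  have hbound (n : ℕ) :
      ‖iteratedDeriv (n + 3) u 0 / (n + 3).factorial‖ ≤ C * (1 / ((n + 1 : ℕ) : ℝ) ^ 2) := by
    have hiter : iteratedDeriv n (iteratedDeriv 3 u) = iteratedDeriv (n + 3) u := by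
      simp only [iteratedDeriv_eq_iterate, Function.iterate_add_apply]
    have hcoeff := norm_iteratedDeriv_div_factorial_le_setIntegral
      (differentiableOn_iteratedDeriv isOpen_ball hu 3) hi n
    rw [hiter] at hcoeff
    have hfact : ((n + 3).factorial : ℝ) = (n + 3) * (n + 2) * (n + 1) * n.factorial := by
      simp only [Nat.factorial_succ]
      push_cast
      ring
    calc ‖iteratedDeriv (n + 3) u 0 / (n + 3).factorial‖
        = ‖iteratedDeriv (n + 3) u 0‖ / n.factorial / ((n + 3) * (n + 2) * (n + 1)) := by
          rw [norm_div, Complex.norm_natCast, hfact, div_div, mul_comm (n.factorial : ℝ)]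
      _ ≤ (n + 2) / (2 * Real.pi) * (∫ z in ball (0 : ℂ) 1, ‖iteratedDeriv 3 u z‖) /
          ((n + 3) * (n + 2) * (n + 1)) := by gcongr
      _ = C * (1 / ((n + 3) * (n + 1))) := by
          simp only [C]
          field_simp
      _ ≤ C * (1 / ((n + 1 : ℕ) : ℝ) ^ 2) := by
          push_cast
          rw [sq]
          gcongr
          norm_num
  rw [← summable_nat_add_iff 3]
  refine .of_nonneg_of_le (fun _ => norm_nonneg _) hbound ?_
  exact ((summable_nat_add_iff 1).2 (Real.summable_one_div_nat_pow.2 one_lt_two)).mul_left C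

theorem exists_continuousOn_closedBall_eqOn_of_summable {u : ℂ → ℂ}
    (hu : DifferentiableOn ℂ u (ball 0 1))
    (hsum : Summable fun n : ℕ => ‖iteratedDeriv n u 0 / n.factorial‖) :
    ∃ V : ℂ → ℂ, ContinuousOn V (closedBall 0 1) ∧ EqOn V u (ball 0 1) := by
  refine ⟨fun z => ∑' n : ℕ, iteratedDeriv n u 0 / n.factorial * z ^ n, ?_, fun z hz => ?_⟩
  · refine continuousOn_tsum (fun n => by fun_prop) hsum fun n z hz => ?_
    rw [norm_mul, norm_pow]
    exact mul_le_of_le_one_right (norm_nonneg _)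
      (pow_le_one₀ (norm_nonneg _) (mem_closedBall_zero_iff.1 hz))
  · simpa [div_eq_inv_mul] using Complex.taylorSeries_eq_on_ball' hz hu

end Disc

section DirectionalDerivative

variable {E F : Type*} [NormedAddCommGroup E] [NormedSpace ℝ E] [NormedAddCommGroup F]
  [NormedSpace ℝ F] {f : E → F}

lemma fderiv_fderiv_apply_comm {z : E} (hf : ContDiffAt ℝ 2 f z) (v w : E) :
    fderiv ℝ (fun y => fderiv ℝ f y w) z v = fderiv ℝ (fun y => fderiv ℝ f y v) z w := by
  have hdiff : DifferentiableAt ℝ (fderiv ℝ f) z :=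
    (hf.fderiv_right (m := 1) (by norm_num)).differentiableAt one_ne_zero
  rw [fderiv_clm_apply hdiff (differentiableAt_const w),
    fderiv_clm_apply hdiff (differentiableAt_const v)]
  simpa using (hf.isSymmSndFDerivAt (by simp)).eq v w

lemma contDiff_fderiv_apply (hf : ContDiff ℝ ∞ f) (v : E) :
    ContDiff ℝ ∞ fun y => fderiv ℝ f y v :=
  (hf.fderiv_right (m := ∞) (by simp)).clm_apply contDiff_const

end DirectionalDerivative

lemma integrable_mul_of_tsupport_subset {X A : Type*} [TopologicalSpace X] [T2Space X]
    [MeasurableSpace X] [OpensMeasurableSpace X] {μ : Measure X} [NormedRing A]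
    [SecondCountableTopologyEither X A] {Ω : Set X} {f φ : X → A}
    (hf : LocallyIntegrableOn f Ω μ) (hφ : Continuous φ) (hc : HasCompactSupport φ)
    (hs : tsupport φ ⊆ Ω) : Integrable (fun z => f z * φ z) μ := by
  have hint : IntegrableOn (fun z => f z * φ z) (tsupport φ) μ :=
    (hf.integrableOn_compact_subset hs hc).mul_continuousOn hφ.continuousOn hc
  refine hint.integrable_of_forall_notMem_eq_zero fun z hz => ?_
  rw [image_eq_zero_of_notMem_tsupport hz, mul_zero]

lemma setIntegral_mul_eq_integral_of_tsupport_subset {X A : Type*} [TopologicalSpace X]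
    [MeasurableSpace X] {μ : Measure X} [NormedRing A] [NormedSpace ℝ A] {Ω : Set X} {f φ : X → A}
    (hs : tsupport φ ⊆ Ω) :
    ∫ z in Ω, f z * φ z ∂μ = ∫ z, f z * φ z ∂μ := by
  refine setIntegral_eq_integral_of_forall_compl_eq_zero fun z hz => ?_
  rw [image_eq_zero_of_notMem_tsupport fun h => hz (hs h), mul_zero]

lemma setIntegral_mul_fderiv_eq_neg {E 𝕜 : Type*} [NormedAddCommGroup E] [NormedSpace ℝ E]
    [FiniteDimensional ℝ E] [MeasurableSpace E] [BorelSpace E] {μ : Measure E} [μ.IsAddHaarMeasure]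
    [NormedField 𝕜] [NormedAlgebra ℝ 𝕜] {Ω : Set E} {f φ : E → 𝕜} (hΩ : IsOpen Ω)
    (hf : ContDiffOn ℝ 1 f Ω) (hφ : ContDiff ℝ 1 φ) (hc : HasCompactSupport φ)
    (hs : tsupport φ ⊆ Ω) (v : E) :
    ∫ z in Ω, f z * fderiv ℝ φ z v ∂μ = -∫ z in Ω, fderiv ℝ f z v * φ z ∂μ := by
  have : ProperSpace E := FiniteDimensional.proper_real E
  have hsub := tsupport_fderiv_apply_subset ℝ (f := φ) v
  have hφ' : Continuous fun z => fderiv ℝ φ z v :=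
    (hφ.continuous_fderiv one_ne_zero).clm_apply continuous_const
  have hfloc : LocallyIntegrableOn f Ω μ := hf.continuousOn.locallyIntegrableOn hΩ.measurableSet
  have hfloc' : LocallyIntegrableOn (fun z => fderiv ℝ f z v) Ω μ :=
    ((hf.continuousOn_fderiv_of_isOpen hΩ le_rfl).clm_apply
      continuousOn_const).locallyIntegrableOn hΩ.measurableSet
  rw [setIntegral_mul_eq_integral_of_tsupport_subset (hsub.trans hs),
    setIntegral_mul_eq_integral_of_tsupport_subset hs]
  exact integral_mul_fderiv_eq_neg_fderiv_mul_of_integrable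
    (integrable_mul_of_tsupport_subset hfloc' hφ.continuous hc hs)
    (integrable_mul_of_tsupport_subset hfloc hφ'
      (hc.of_isClosed_subset (isClosed_tsupport _) hsub) (hsub.trans hs))
    (integrable_mul_of_tsupport_subset hfloc hφ.continuous hc hs)
    (fun z hz => (hf.contDiffAt (hΩ.mem_nhds (hs hz))).differentiableAt one_ne_zero)
    fun z _ => hφ.contDiffAt.differentiableAt one_ne_zero

instance isAddHaarMeasure_volume_complex_prod : (volume : Measure (ℂ × ℂ)).IsAddHaarMeasure := by
  rw [Measure.volume_eq_prod]
  infer_instance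

section Sobolev

variable {Ω : Set (ℂ × ℂ)} {f φ : ℂ × ℂ → ℂ} {z : ℂ × ℂ} {j k : ℕ}

lemma contDiffAt_partialDeriv (w : Fin j → Fin 4) (hf : ContDiffAt ℝ ∞ f z) :
    ContDiffAt ℝ ∞ (partialDeriv w f) z :=
  (ContinuousMultilinearMap.apply ℝ (fun _ : Fin j => ℂ × ℂ) ℂ
    fun i => coordDir (w i)).contDiff.contDiffAt.comp z
      (hf.iteratedFDeriv_right (m := ∞) (i := j) (mod_cast le_top))

lemma contDiffOn_partialDeriv (hΩ : IsOpen Ω) (w : Fin j → Fin 4) (hf : ContDiffOn ℝ ∞ f Ω) :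
    ContDiffOn ℝ ∞ (partialDeriv w f) Ω :=
  fun _ hz => (contDiffAt_partialDeriv w (hf.contDiffAt (hΩ.mem_nhds hz))).contDiffWithinAt

lemma partialDeriv_zero (w : Fin 0 → Fin 4) (f : ℂ × ℂ → ℂ) : partialDeriv w f = f := by
  ext z
  exact iteratedFDeriv_zero_apply _

lemma partialDeriv_succ (w : Fin (j + 1) → Fin 4) (hf : ContDiffAt ℝ ∞ f z) :
    partialDeriv w f z = fderiv ℝ (partialDeriv (Fin.tail w) f) z (coordDir (w 0)) :=
  ((hf.iteratedFDeriv_right (m := ∞) (i := j) (mod_cast le_top)).differentiableAt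
    (by simp)).iteratedFDeriv_succ_apply_left'

lemma fderiv_partialDeriv_apply (hφ : ContDiff ℝ ∞ φ) (w : Fin j → Fin 4) (v : ℂ × ℂ) :
    (fun z => fderiv ℝ (partialDeriv w φ) z v) =
      partialDeriv w fun y => fderiv ℝ φ y v := by
  induction j with
  | zero => simp only [partialDeriv_zero]
  | succ j ih =>
    have hleft : partialDeriv w φ =
        fun z => fderiv ℝ (partialDeriv (Fin.tail w) φ) z (coordDir (w 0)) :=
      funext fun z => partialDeriv_succ w hφ.contDiffAt
    ext z
    have htail : ContDiffAt ℝ 2 (partialDeriv (Fin.tail w) φ) z :=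
      (contDiffAt_partialDeriv _ hφ.contDiffAt).of_le ENat.LEInfty.out
    rw [hleft, fderiv_fderiv_apply_comm htail, ih,
      partialDeriv_succ w (contDiff_fderiv_apply hφ v).contDiffAt]

lemma partialDeriv_succ' (w : Fin (j + 1) → Fin 4) (hφ : ContDiff ℝ ∞ φ) :
    partialDeriv w φ = partialDeriv (Fin.tail w) fun y => fderiv ℝ φ y (coordDir (w 0)) := by
  rw [← fderiv_partialDeriv_apply hφ]
  exact funext fun z => partialDeriv_succ w hφ.contDiffAt

lemma setIntegral_mul_partialDeriv (hΩ : IsOpen Ω) (hf : ContDiffOn ℝ ∞ f Ω)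
    (w : Fin j → Fin 4) (hφ : ContDiff ℝ ∞ φ) (hc : HasCompactSupport φ) (hs : tsupport φ ⊆ Ω) :
    ∫ z in Ω, f z * partialDeriv w φ z = (-1) ^ j * ∫ z in Ω, partialDeriv w f z * φ z := by
  induction j generalizing φ with
  | zero => simp only [partialDeriv_zero, pow_zero, one_mul]
  | succ j ih =>
    have hsub := tsupport_fderiv_apply_subset ℝ (f := φ) (coordDir (w 0))
    have htail : ContDiffOn ℝ 1 (partialDeriv (Fin.tail w) f) Ω :=
      (contDiffOn_partialDeriv hΩ _ hf).of_le ENat.LEInfty.out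
    rw [partialDeriv_succ' w hφ, ih (Fin.tail w) (contDiff_fderiv_apply hφ _)
      (hc.of_isClosed_subset (isClosed_tsupport _) hsub) (hsub.trans hs),
      setIntegral_mul_fderiv_eq_neg hΩ htail (hφ.of_le ENat.LEInfty.out) hc hs, pow_succ,
      mul_assoc, neg_one_mul]
    congr 2
    refine setIntegral_congr_fun hΩ.measurableSet fun z hz => ?_
    simp only [partialDeriv_succ w (hf.contDiffAt (hΩ.mem_nhds hz))]

theorem hasWeakDeriv_partialDeriv (hΩ : IsOpen Ω) (hf : ContDiffOn ℝ ∞ f Ω) (w : Fin j → Fin 4) :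
    HasWeakDeriv Ω w f (partialDeriv w f) :=
  ⟨hf.continuousOn.locallyIntegrableOn hΩ.measurableSet,
    (contDiffOn_partialDeriv hΩ w hf).continuousOn.locallyIntegrableOn hΩ.measurableSet,
    fun _ hφ hc hs => setIntegral_mul_partialDeriv hΩ hf w hφ hc hs⟩

theorem HasWeakDeriv.ae_unique (hΩ : IsOpen Ω) {w : Fin j → Fin 4} {v₁ v₂ : ℂ × ℂ → ℂ}
    (h₁ : HasWeakDeriv Ω w f v₁) (h₂ : HasWeakDeriv Ω w f v₂) :
    v₁ =ᵐ[volume.restrict Ω] v₂ := by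
  suffices hzero : ∀ᵐ z, z ∈ Ω → v₁ z - v₂ z = 0 by
    rw [Filter.EventuallyEq, ae_restrict_iff' hΩ.measurableSet]
    filter_upwards [hzero] with z hz hzΩ using sub_eq_zero.1 (hz hzΩ)
  refine hΩ.ae_eq_zero_of_integral_contDiff_smul_eq_zero (h₁.2.1.sub h₂.2.1) fun ψ hψ hc hs => ?_
  let φ : ℂ × ℂ → ℂ := fun z => ψ z
  have hφ : ContDiff ℝ ∞ φ := Complex.ofRealCLM.contDiff.comp hψ
  have htsupport : tsupport φ = tsupport ψ := by
    simp only [tsupport, φ, Function.support, ne_eq, Complex.ofReal_eq_zero]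
  have hcφ : HasCompactSupport φ := by rwa [HasCompactSupport, htsupport]
  have hsφ : tsupport φ ⊆ Ω := by rwa [htsupport]
  have heq : ∫ z in Ω, v₁ z * φ z = ∫ z in Ω, v₂ z * φ z :=
    mul_left_cancel₀ (pow_ne_zero j (neg_ne_zero.2 one_ne_zero))
      ((h₁.2.2 φ hφ hcφ hsφ).symm.trans (h₂.2.2 φ hφ hcφ hsφ))
  rw [setIntegral_mul_eq_integral_of_tsupport_subset hsφ,
    setIntegral_mul_eq_integral_of_tsupport_subset hsφ] at heq
  calc ∫ z, ψ z • (v₁ z - v₂ z) = ∫ z, (v₁ z * φ z - v₂ z * φ z) := by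
        simp only [φ, Complex.real_smul, mul_sub, mul_comm]
    _ = 0 := by
        rw [integral_sub (integrable_mul_of_tsupport_subset h₁.2.1 hφ.continuous hcφ hsφ)
          (integrable_mul_of_tsupport_subset h₂.2.1 hφ.continuous hcφ hsφ), heq, sub_self]

lemma MemSobolev.congr_ae {f' : ℂ × ℂ → ℂ} (hf : MemSobolev Ω k f)
    (h : f =ᵐ[volume.restrict Ω] f') : MemSobolev Ω k f' := by
  refine ⟨hf.1.ae_eq h, fun j hj w => ?_⟩
  obtain ⟨v, ⟨-, hv, hparts⟩, hv2⟩ := hf.2 j hj w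
  refine ⟨v, ⟨?_, hv, fun φ hφ hc hs => ?_⟩, hv2⟩
  · exact locallyIntegrableOn_of_locallyIntegrable_restrict
      ((hf.1.ae_eq h).locallyIntegrable one_le_two)
  · rw [← hparts φ hφ hc hs]
    refine integral_congr_ae ?_
    filter_upwards [h] with z hz
    rw [hz]

lemma MemSobolev.memLp_partialDeriv (hΩ : IsOpen Ω) (hsm : ContDiffOn ℝ ∞ f Ω)
    (hf : MemSobolev Ω k f) (hj : j ≤ k) (w : Fin j → Fin 4) :
    MemLp (partialDeriv w f) 2 (volume.restrict Ω) := by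
  obtain ⟨v, hv, hv2⟩ := hf.2 j hj w
  exact hv2.ae_eq (hv.ae_unique hΩ (hasWeakDeriv_partialDeriv hΩ hsm w))

lemma MemSmoothBounded.memLp_partialDeriv (hΩ : IsOpen Ω) (hvol : volume Ω ≠ ⊤)
    (hf : MemSmoothBounded Ω f) (w : Fin j → Fin 4) :
    MemLp (partialDeriv w f) 2 (volume.restrict Ω) := by
  have : IsFiniteMeasure (volume.restrict Ω) := isFiniteMeasure_restrict.2 hvol
  obtain ⟨M, hM⟩ := hf.2 j w
  exact .of_bound ((contDiffOn_partialDeriv hΩ w hf.1).continuousOn.aestronglyMeasurable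
    hΩ.measurableSet) M (ae_restrict_of_forall_mem hΩ.measurableSet hM)

lemma MemSmoothBounded.memLp (hΩ : IsOpen Ω) (hvol : volume Ω ≠ ⊤) (hf : MemSmoothBounded Ω f) :
    MemLp f 2 (volume.restrict Ω) :=
  partialDeriv_zero ![] f ▸ hf.memLp_partialDeriv hΩ hvol ![]

theorem MemSmoothBounded.memSobolev (hΩ : IsOpen Ω) (hvol : volume Ω ≠ ⊤)
    (hf : MemSmoothBounded Ω f) (k : ℕ) : MemSobolev Ω k f :=
  ⟨hf.memLp hΩ hvol, fun _ _ w =>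
    ⟨_, hasWeakDeriv_partialDeriv hΩ hf.1 w, hf.memLp_partialDeriv hΩ hvol w⟩⟩

lemma memSmoothBounded_of_contDiff (hΩ : Bornology.IsBounded Ω) (hf : ContDiff ℝ ∞ f) :
    MemSmoothBounded Ω f := by
  refine ⟨hf.contDiffOn, fun j w => ?_⟩
  have hcont : Continuous (partialDeriv w f) :=
    continuous_iff_continuousAt.2 fun _ => (contDiffAt_partialDeriv w hf.contDiffAt).continuousAt
  obtain ⟨M, hM⟩ := hΩ.isCompact_closure.exists_bound_of_continuousOn hcont.continuousOn
  exact ⟨M, fun z hz => hM z (subset_closure hz)⟩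

end Sobolev

section ChangeOfVariables

variable {g : ℂ → ℂ}

lemma injOn_hartogsParam (hg0 : ∀ z ∈ ball (0 : ℂ) 1, g z ≠ 0) :
    InjOn (hartogsParam g) (ball 0 1) := by
  rintro ⟨a, s⟩ hp ⟨b, t⟩ - h
  obtain ⟨rfl, h⟩ := Prod.mk.inj h
  exact Prod.ext rfl (mul_left_cancel₀ (hg0 a (mem_ball_zero_prod_iff.1 hp).1) h)

/-- The complex derivative of `hartogsParam g` at `p`. -/
noncomputable def hartogsParamDeriv (g : ℂ → ℂ) (p : ℂ × ℂ) : ℂ × ℂ →L[ℂ] ℂ × ℂ :=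
  (ContinuousLinearMap.fst ℂ ℂ ℂ).prod
    (g p.1 • ContinuousLinearMap.snd ℂ ℂ ℂ + p.2 • deriv g p.1 • ContinuousLinearMap.fst ℂ ℂ ℂ)

lemma hasFDerivWithinAt_hartogsParam (hg : DifferentiableOn ℂ g (ball 0 1)) {p : ℂ × ℂ}
    (hp : p ∈ ball 0 1) : HasFDerivWithinAt (hartogsParam g)
      ((hartogsParamDeriv g p).restrictScalars ℝ) (ball 0 1) p := by
  have hgp : HasDerivAt g (deriv g p.1) p.1 :=
    (hg.differentiableAt (isOpen_ball.mem_nhds (mem_ball_zero_prod_iff.1 hp).1)).hasDerivAt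
  have hparam : HasFDerivAt (hartogsParam g) (hartogsParamDeriv g p) p :=
    hasFDerivAt_fst.prodMk ((hgp.comp_hasFDerivAt p hasFDerivAt_fst).mul hasFDerivAt_snd)
  exact (hparam.restrictScalars ℝ).hasFDerivWithinAt

lemma det_restrictScalars_hartogsParamDeriv (g : ℂ → ℂ) (p : ℂ × ℂ) :
    ((hartogsParamDeriv g p).restrictScalars ℝ).det = ‖g p.1‖ ^ 2 := by
  have hdet : LinearMap.det (hartogsParamDeriv g p : ℂ × ℂ →ₗ[ℂ] ℂ × ℂ) = g p.1 := by
    rw [← LinearMap.det_toMatrix (Module.Basis.finTwoProd ℂ), Matrix.det_fin_two]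
    simp [LinearMap.toMatrix_apply, hartogsParamDeriv]
  calc ((hartogsParamDeriv g p).restrictScalars ℝ).det
      = Algebra.norm ℝ (LinearMap.det (hartogsParamDeriv g p : ℂ × ℂ →ₗ[ℂ] ℂ × ℂ)) :=
        LinearMap.det_restrictScalars
    _ = ‖g p.1‖ ^ 2 := by
        rw [hdet, Algebra.norm_complex_eq]
        exact Complex.normSq_eq_norm_sq _

variable {E : Type*} [NormedAddCommGroup E] [NormedSpace ℝ E]

lemma integrableOn_hartogsDomain_iff (hg : DifferentiableOn ℂ g (ball 0 1))
    (hg0 : ∀ z ∈ ball (0 : ℂ) 1, g z ≠ 0) (F : ℂ × ℂ → E) :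
    IntegrableOn F (hartogsDomain g) ↔
      IntegrableOn (fun p => ‖g p.1‖ ^ 2 • F (hartogsParam g p)) (ball 0 1) := by
  rw [← hartogsParam_image_ball hg0, integrableOn_image_iff_integrableOn_abs_det_fderiv_smul volume
    measurableSet_ball (fun _ => hasFDerivWithinAt_hartogsParam hg) (injOn_hartogsParam hg0)]
  simp only [det_restrictScalars_hartogsParamDeriv, abs_pow, abs_norm]

lemma setIntegral_hartogsDomain (hg : DifferentiableOn ℂ g (ball 0 1))
    (hg0 : ∀ z ∈ ball (0 : ℂ) 1, g z ≠ 0) (F : ℂ × ℂ → E) :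
    ∫ z in hartogsDomain g, F z =
      ∫ p in ball (0 : ℂ × ℂ) 1, ‖g p.1‖ ^ 2 • F (hartogsParam g p) := by
  rw [← hartogsParam_image_ball hg0, integral_image_eq_integral_abs_det_fderiv_smul volume
    measurableSet_ball (fun _ => hasFDerivWithinAt_hartogsParam hg) (injOn_hartogsParam hg0)]
  simp only [det_restrictScalars_hartogsParamDeriv, abs_pow, abs_norm]

lemma volume_restrict_ball_prod : (volume : Measure (ℂ × ℂ)).restrict (ball 0 1) =
    (volume.restrict (ball (0 : ℂ) 1)).prod (volume.restrict (ball 0 1)) := by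
  rw [Measure.prod_restrict, ball_prod_same, Measure.volume_eq_prod, Prod.mk_zero_zero]

end ChangeOfVariables

section BergmanProjection

variable {g : ℂ → ℂ}

lemma differentiableOn_inv_sq (hg : DifferentiableOn ℂ g (ball 0 1))
    (hg0 : ∀ z ∈ ball (0 : ℂ) 1, g z ≠ 0) :
    DifferentiableOn ℂ (fun z => (g z ^ 2)⁻¹) (ball 0 1) :=
  (hg.pow 2).inv fun z hz => pow_ne_zero 2 (hg0 z hz)

/-- The holomorphic function `z₂ / g(z₁)²` on the Hartogs domain of `g`. -/
noncomputable def sndDivSq (g : ℂ → ℂ) (z : ℂ × ℂ) : ℂ := z.2 * (g z.1 ^ 2)⁻¹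

lemma differentiableOn_sndDivSq (hg : DifferentiableOn ℂ g (ball 0 1))
    (hg0 : ∀ z ∈ ball (0 : ℂ) 1, g z ≠ 0) :
    DifferentiableOn ℂ (sndDivSq g) (hartogsDomain g) :=
  differentiableOn_snd.mul
    ((differentiableOn_inv_sq hg hg0).comp differentiableOn_fst fun _ hz => hz.1)

lemma contDiffOn_sndDivSq (hg : DifferentiableOn ℂ g (ball 0 1))
    (hg0 : ∀ z ∈ ball (0 : ℂ) 1, g z ≠ 0) : ContDiffOn ℝ ∞ (sndDivSq g) (hartogsDomain g) :=
  contDiffOn_snd.mul ((((differentiableOn_inv_sq hg hg0).contDiffOn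
    isOpen_ball).restrict_scalars ℝ).comp contDiffOn_fst fun _ hz => hz.1)

lemma memLp_sndDivSq (hg : DifferentiableOn ℂ g (ball 0 1))
    (hg0 : ∀ z ∈ ball (0 : ℂ) 1, g z ≠ 0) :
    MemLp (sndDivSq g) 2 (volume.restrict (hartogsDomain g)) := by
  have hmeas : AEStronglyMeasurable (sndDivSq g) (volume.restrict (hartogsDomain g)) :=
    (differentiableOn_sndDivSq hg hg0).continuousOn.aestronglyMeasurable
      (isOpen_hartogsDomain hg.continuousOn).measurableSet
  rw [memLp_two_iff_integrable_sq_norm hmeas, ← IntegrableOn, integrableOn_hartogsDomain_iff hg hg0]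
  have hsnd : IntegrableOn (fun p : ℂ × ℂ => ‖p.2‖ ^ 2) (ball 0 1) :=
    ((by fun_prop : Continuous fun p : ℂ × ℂ => ‖p.2‖ ^ 2).continuousOn.integrableOn_compact
      (isCompact_closedBall 0 1)).mono_set ball_subset_closedBall
  refine hsnd.congr_fun (fun p hp => ?_) measurableSet_ball
  have hgp : ‖g p.1‖ ≠ 0 := norm_ne_zero_iff.2 (hg0 _ (mem_ball_zero_prod_iff.1 hp).1)
  simp only [sndDivSq, hartogsParam, norm_mul, norm_inv, norm_pow, smul_eq_mul]
  field_simp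

lemma norm_sq_smul_conj_sndDivSq_hartogsParam {p : ℂ × ℂ} (hp : g p.1 ≠ 0) (η : ℝ) (c : ℂ) :
    ‖g p.1‖ ^ 2 • (starRingEnd ℂ (η * sndDivSq g (hartogsParam g p)) * c) =
      η * (starRingEnd ℂ p.2 * (g p.1 * c)) := by
  have hconj : starRingEnd ℂ (g p.1) ≠ 0 := (map_ne_zero _).2 hp
  have hnorm : ((‖g p.1‖ ^ 2 : ℝ) : ℂ) = g p.1 * starRingEnd ℂ (g p.1) := by
    rw [Complex.mul_conj, Complex.normSq_eq_norm_sq]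
  simp only [sndDivSq, hartogsParam, Complex.real_smul, hnorm, map_mul, map_inv₀, map_pow,
    Complex.conj_ofReal]
  field_simp

theorem setIntegral_conj_radial_mul_sndDivSq_mul_eq_zero (hg : DifferentiableOn ℂ g (ball 0 1))
    (hg0 : ∀ z ∈ ball (0 : ℂ) 1, g z ≠ 0) {η : ℝ → ℝ} (hη : ∫ z in ball (0 : ℂ) 1, η ‖z‖ = 0)
    {G : ℂ × ℂ → ℂ} (hG : DifferentiableOn ℂ G (hartogsDomain g)) :
    ∫ z in hartogsDomain g, starRingEnd ℂ (η ‖z.1‖ * sndDivSq g z) * G z = 0 := by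
  by_cases hi : IntegrableOn (fun z => starRingEnd ℂ (η ‖z.1‖ * sndDivSq g z) * G z)
    (hartogsDomain g)
  swap
  · exact integral_undef hi
  have hpull : EqOn (fun p => ‖g p.1‖ ^ 2 • (starRingEnd ℂ (η ‖(hartogsParam g p).1‖ *
      sndDivSq g (hartogsParam g p)) * G (hartogsParam g p)))
      (fun p => η ‖p.1‖ * (starRingEnd ℂ p.2 * (g p.1 * G (hartogsParam g p)))) (ball 0 1) :=
    fun p hp => norm_sq_smul_conj_sndDivSq_hartogsParam
      (hg0 _ (mem_ball_zero_prod_iff.1 hp).1) _ _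
  rw [integrableOn_hartogsDomain_iff hg hg0, integrableOn_congr_fun hpull measurableSet_ball,
    IntegrableOn, volume_restrict_ball_prod] at hi
  rw [setIntegral_hartogsDomain hg hg0, setIntegral_congr_fun measurableSet_ball hpull,
    volume_restrict_ball_prod, integral_prod_symm _ hi]
  refine integral_eq_zero_of_ae ?_
  filter_upwards [hi.prod_left_ae, ae_restrict_mem measurableSet_ball] with t ht htball
  have hslice : DifferentiableOn ℂ (fun z => starRingEnd ℂ t * (g z * G (hartogsParam g (z, t))))
      (ball 0 1) := by
    refine (hg.mul ?_).const_mul _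
    refine hG.comp (differentiableOn_id.prodMk (hg.mul_const t)) fun z hz => ?_
    rw [← hartogsParam_image_ball hg0]
    exact mem_image_of_mem _ ((mem_ball_zero_prod_iff (p := (z, t))).2 ⟨hz, htball⟩)
  have hradial := setIntegral_radial_mul (ρ := fun r => η r) hslice ht
  rwa [integral_complex_ofReal, hη, Complex.ofReal_zero, zero_mul] at hradial

theorem bergmanProjection_radial_mul_sndDivSq (hg : DifferentiableOn ℂ g (ball 0 1))
    (hg0 : ∀ z ∈ ball (0 : ℂ) 1, g z ≠ 0) {ρ : ℝ → ℝ} (hρ : ⨍ z in ball (0 : ℂ) 1, ρ ‖z‖ = 1)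
    {f : L2 (hartogsDomain g)}
    (hf : f =ᵐ[volume.restrict (hartogsDomain g)] fun z => ρ ‖z.1‖ * sndDivSq g z) :
    bergmanProjection (hartogsDomain g) f =ᵐ[volume.restrict (hartogsDomain g)] sndDivSq g := by
  have hm := memLp_sndDivSq hg hg0
  have hball : IsFiniteMeasure (volume.restrict (ball (0 : ℂ) 1)) :=
    isFiniteMeasure_restrict.2 measure_ball_lt_top.ne
  have hmean : ∫ z in ball (0 : ℂ) 1, (ρ ‖z‖ - 1) = 0 := by
    simpa only [hρ] using integral_sub_average (volume.restrict (ball (0 : ℂ) 1)) fun z => ρ ‖z‖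
  suffices hproj : bergmanProjection (hartogsDomain g) f = hm.toLp from hproj ▸ hm.coeFn_toLp
  refine Submodule.eq_starProjection_of_mem_orthogonal
    (Submodule.le_topologicalClosure _ ⟨_, differentiableOn_sndDivSq hg hg0, hm.coeFn_toLp⟩) ?_
  rw [Submodule.orthogonal_closure, Submodule.mem_orthogonal']
  rintro G ⟨F, hF, hGF⟩
  rw [L2.inner_def, ← setIntegral_conj_radial_mul_sndDivSq_mul_eq_zero hg hg0
    (η := fun r => ρ r - 1) hmean hF]
  refine integral_congr_ae ?_
  filter_upwards [hGF, hf, hm.coeFn_toLp, Lp.coeFn_sub f hm.toLp] with z hGz hfz hmz hsub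
  rw [hsub, Pi.sub_apply, hGz, hfz, hmz, RCLike.inner_apply, mul_comm, Complex.ofReal_sub,
    Complex.ofReal_one, sub_one_mul]

lemma exists_radial_contDiff_average_eq_one : ∃ ρ : ℝ → ℝ, ContDiff ℝ ∞ (fun z : ℂ => ρ ‖z‖) ∧
    tsupport (fun z : ℂ => ρ ‖z‖) ⊆ ball 0 1 ∧ ⨍ z in ball (0 : ℂ) 1, ρ ‖z‖ = 1 := by
  let χ : ℝ → ℝ := fun r => Real.smoothTransition (1 / 2 - r ^ 2)
  have hχ : ContDiff ℝ ∞ fun z : ℂ => χ ‖z‖ :=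
    Real.smoothTransition.contDiff.comp (contDiff_const.sub (contDiff_norm_sq ℝ))
  have hsupport : Function.support (fun z : ℂ => χ ‖z‖) ⊆ {z | ‖z‖ ^ 2 ≤ 1 / 2} := fun z hz => by
    by_contra hlt
    exact hz (Real.smoothTransition.zero_of_nonpos (sub_nonpos.2 (not_le.1 hlt).le))
  have htsupport : tsupport (fun z : ℂ => χ ‖z‖) ⊆ ball 0 1 :=
    (closure_minimal hsupport (isClosed_le (by fun_prop) (by fun_prop))).trans fun z hz =>
      mem_ball_zero_iff.2 ((sq_lt_one_iff₀ (norm_nonneg z)).1 (hz.trans_lt (by norm_num)))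
  have hcompact : HasCompactSupport fun z : ℂ => χ ‖z‖ :=
    (isCompact_closedBall 0 1).of_isClosed_subset (isClosed_tsupport _)
      (htsupport.trans ball_subset_closedBall)
  have hpos : 0 < ⨍ z in ball (0 : ℂ) 1, χ ‖z‖ := by
    rw [setAverage_eq, setIntegral_eq_integral_of_forall_compl_eq_zero fun z hz =>
      image_eq_zero_of_notMem_tsupport fun h => hz (htsupport h)]
    refine smul_pos (inv_pos.2 (ENNReal.toReal_pos (measure_ball_pos _ _ one_pos).ne'
      measure_ball_lt_top.ne))
      (hχ.continuous.integral_pos_of_hasCompactSupport_nonneg_nonzero hcompact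
        (fun z => Real.smoothTransition.nonneg _) (x := 0) ?_)
    exact (Real.smoothTransition.pos_of_pos (by norm_num)).ne'
  refine ⟨fun r => (⨍ z in ball (0 : ℂ) 1, χ ‖z‖)⁻¹ * χ r, contDiff_const.mul hχ,
    tsupport_mul_subset_right.trans htsupport, ?_⟩
  exact (integral_const_mul _ _).trans (inv_mul_cancel₀ hpos.ne')

lemma contDiff_mul_of_tsupport_subset {E A : Type*} [NormedAddCommGroup E] [NormedSpace ℝ E]
    [NormedRing A] [NormedAlgebra ℝ A] {U : Set E} (hU : IsOpen U) {χ u : E → A}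
    (hχ : ContDiff ℝ ∞ χ) (hs : tsupport χ ⊆ U) (hu : ContDiffOn ℝ ∞ u U) :
    ContDiff ℝ ∞ fun z => χ z * u z := by
  refine contDiff_iff_contDiffAt.2 fun z => ?_
  by_cases hz : z ∈ tsupport χ
  · exact hχ.contDiffAt.mul (hu.contDiffAt (hU.mem_nhds (hs hz)))
  · refine contDiffAt_const (c := 0) |>.congr_of_eventuallyEq ?_
    filter_upwards [notMem_tsupport_iff_eventuallyEq.1 hz] with y hy
    rw [hy, Pi.zero_apply, zero_mul]

theorem exists_memSmoothBounded_bergmanProjection_eq_sndDivSq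
    (hg : DifferentiableOn ℂ g (ball 0 1)) (hg0 : ∀ z ∈ ball (0 : ℂ) 1, g z ≠ 0)
    (hΩ : Bornology.IsBounded (hartogsDomain g)) :
    ∃ (F : ℂ × ℂ → ℂ) (f : L2 (hartogsDomain g)), MemSmoothBounded (hartogsDomain g) F ∧
      f =ᵐ[volume.restrict (hartogsDomain g)] F ∧
      bergmanProjection (hartogsDomain g) f =ᵐ[volume.restrict (hartogsDomain g)] sndDivSq g := by
  obtain ⟨ρ, hρ, hsupport, hmean⟩ := exists_radial_contDiff_average_eq_one
  have hcutoff : ContDiff ℝ ∞ fun z : ℂ => (ρ ‖z‖ : ℂ) * (g z ^ 2)⁻¹ :=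
    contDiff_mul_of_tsupport_subset isOpen_ball (Complex.ofRealCLM.contDiff.comp hρ)
      ((tsupport_comp_subset Complex.ofReal_zero _).trans hsupport)
      (((differentiableOn_inv_sq hg hg0).contDiffOn isOpen_ball).restrict_scalars ℝ)
  have hF : MemSmoothBounded (hartogsDomain g) fun z => ρ ‖z.1‖ * sndDivSq g z := by
    simp only [sndDivSq, mul_left_comm _ (_ : ℂ × ℂ).2]
    exact memSmoothBounded_of_contDiff hΩ (contDiff_snd.mul (hcutoff.comp contDiff_fst))
  have hm := hF.memLp (isOpen_hartogsDomain hg.continuousOn) hΩ.measure_lt_top.ne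
  exact ⟨_, hm.toLp, hF, hm.coeFn_toLp,
    bergmanProjection_radial_mul_sndDivSq hg hg0 hmean hm.coeFn_toLp⟩

end BergmanProjection

section BoundaryRegularity

variable {g : ℂ → ℂ}

lemma exists_partialDeriv_sndDivSq (hg : DifferentiableOn ℂ g (ball 0 1))
    (hg0 : ∀ z ∈ ball (0 : ℂ) 1, g z ≠ 0) (n : ℕ) :
    ∃ w : Fin (n + 1) → Fin 4, ∀ z ∈ hartogsDomain g,
      partialDeriv w (sndDivSq g) z = iteratedDeriv n (fun z => (g z ^ 2)⁻¹) z.1 := by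
  have hΩ := isOpen_hartogsDomain hg.continuousOn
  have hderiv {v : ℂ → ℂ} (hv : DifferentiableOn ℂ v (ball 0 1)) {z : ℂ × ℂ}
      (hz : z ∈ hartogsDomain g) : HasFDerivAt (fun z : ℂ × ℂ => v z.1)
        (deriv v z.1 • ContinuousLinearMap.fst ℂ ℂ ℂ) z :=
    (hv.differentiableAt (isOpen_ball.mem_nhds hz.1)).hasDerivAt.comp_hasFDerivAt z hasFDerivAt_fst
  have hsm {z} (hz : z ∈ hartogsDomain g) : ContDiffAt ℝ ∞ (sndDivSq g) z :=
    (contDiffOn_sndDivSq hg hg0).contDiffAt (hΩ.mem_nhds hz)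
  have hu := differentiableOn_inv_sq hg hg0
  induction n with
  | zero =>
    refine ⟨![2], fun z hz => ?_⟩
    have hmul : HasFDerivAt (sndDivSq g) _ z := hasFDerivAt_snd.mul (hderiv hu hz)
    rw [partialDeriv_succ _ (hsm hz), partialDeriv_zero, (hmul.restrictScalars ℝ).fderiv]
    simp [coordDir]
  | succ n ih =>
    obtain ⟨w, hw⟩ := ih
    refine ⟨Fin.cons 0 w, fun z hz => ?_⟩
    have hev : partialDeriv w (sndDivSq g) =ᶠ[𝓝 z]
        fun z => iteratedDeriv n (fun z => (g z ^ 2)⁻¹) z.1 :=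
      eventually_of_mem (hΩ.mem_nhds hz) hw
    rw [partialDeriv_succ _ (hsm hz), Fin.tail_cons, hev.fderiv_eq, iteratedDeriv_succ,
      ((hderiv (differentiableOn_iteratedDeriv isOpen_ball hu n) hz).restrictScalars ℝ).fderiv]
    simp [coordDir]

lemma memLp_mul_of_memLp_comp_fst {v : ℂ → ℂ} (hg : DifferentiableOn ℂ g (ball 0 1))
    (hg0 : ∀ z ∈ ball (0 : ℂ) 1, g z ≠ 0) (hv : ContinuousOn v (ball 0 1))
    (hvΩ : MemLp (fun z : ℂ × ℂ => v z.1) 2 (volume.restrict (hartogsDomain g))) :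
    MemLp (fun z => v z * g z) 2 (volume.restrict (ball 0 1)) := by
  have hmeas : AEStronglyMeasurable (fun z => v z * g z) (volume.restrict (ball 0 1)) :=
    (hv.mul hg.continuousOn).aestronglyMeasurable measurableSet_ball
  rw [memLp_two_iff_integrable_sq_norm hmeas]
  have hint : IntegrableOn (fun z : ℂ × ℂ => ‖v z.1‖ ^ 2) (hartogsDomain g) :=
    hvΩ.integrable_norm_pow two_ne_zero
  rw [integrableOn_hartogsDomain_iff hg hg0, IntegrableOn, volume_restrict_ball_prod] at hint
  have : (ae (volume.restrict (ball (0 : ℂ) 1))).NeBot :=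
    ae_restrict_neBot.2 (measure_ball_pos _ _ one_pos).ne'
  obtain ⟨t, ht⟩ := hint.prod_left_ae.exists
  refine ht.congr (Eventually.of_forall fun z => ?_)
  simp only [hartogsParam, smul_eq_mul, norm_mul, mul_pow, mul_comm]

theorem integrableOn_iteratedDeriv_inv_sq (hg : DifferentiableOn ℂ g (ball 0 1))
    (hg0 : ∀ z ∈ ball (0 : ℂ) 1, g z ≠ 0) {n : ℕ}
    (hS : MemSobolev (hartogsDomain g) (n + 1) (sndDivSq g)) :
    IntegrableOn (iteratedDeriv n fun z => (g z ^ 2)⁻¹) (ball 0 1) := by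
  have hu := differentiableOn_inv_sq hg hg0
  have hΩ := isOpen_hartogsDomain hg.continuousOn
  have hL2 {j : ℕ} (hj : j ≤ n) : MemLp (fun z => iteratedDeriv j (fun z => (g z ^ 2)⁻¹) z * g z) 2
      (volume.restrict (ball 0 1)) := by
    obtain ⟨w, hw⟩ := exists_partialDeriv_sndDivSq hg hg0 j
    refine memLp_mul_of_memLp_comp_fst hg hg0
      (differentiableOn_iteratedDeriv isOpen_ball hu j).continuousOn ?_
    exact (hS.memLp_partialDeriv hΩ (contDiffOn_sndDivSq hg hg0) (Nat.succ_le_succ hj) w).ae_eq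
      (ae_restrict_of_forall_mem hΩ.measurableSet hw)
  refine IntegrableOn.congr_fun ((hL2 le_rfl).integrable_mul (hL2 n.zero_le)) (fun z hz => ?_)
    measurableSet_ball
  have hgz := hg0 z hz
  simp only [Pi.mul_apply, iteratedDeriv_zero]
  field_simp

theorem hasSteinNeighborhoodBasis_of_inv_sq_extension {V : ℂ → ℂ}
    (hg : DifferentiableOn ℂ g (ball 0 1)) (hg0 : ∀ z ∈ ball (0 : ℂ) 1, g z ≠ 0)
    (hbdd : ∃ M : ℝ, ∀ z ∈ ball (0 : ℂ) 1, ‖g z‖ ≤ M) (hV : ContinuousOn V (closedBall 0 1))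
    (hVg : EqOn V (fun z => (g z ^ 2)⁻¹) (ball 0 1)) :
    HasSteinNeighborhoodBasis (closure (hartogsDomain g)) := by
  obtain ⟨M, hM⟩ := hbdd
  have hM0 : 0 < M :=
    (norm_pos_iff.2 (hg0 0 (mem_ball_self one_pos))).trans_le (hM 0 (mem_ball_self one_pos))
  have hVlow : ∀ z ∈ closedBall (0 : ℂ) 1, (M ^ 2)⁻¹ ≤ ‖V z‖ := by
    rw [← closure_ball (0 : ℂ) one_ne_zero] at hV ⊢
    refine fun z hz => le_on_closure (f := fun _ => (M ^ 2)⁻¹) (fun y hy => ?_) continuousOn_const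
      hV.norm hz
    have hgy := norm_pos_iff.2 (hg0 y hy)
    rw [hVg hy, norm_inv, norm_pow]
    gcongr
    exact hM y hy
  have hVpos : ∀ z ∈ closedBall (0 : ℂ) 1, 0 < √‖V z‖ := fun z hz =>
    Real.sqrt_pos.2 ((inv_pos.2 (pow_pos hM0 2)).trans_le (hVlow z hz))
  have hsqrt : ContinuousOn (fun z => (√‖V z‖)⁻¹) (closedBall 0 1) :=
    hV.norm.sqrt.inv₀ fun z hz => (hVpos z hz).ne'
  obtain ⟨ψ, hψ⟩ := ContinuousMap.exists_restrict_eq isClosed_closedBall ⟨_, hsqrt.domRestrict⟩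
  have hψV : ∀ z ∈ closedBall (0 : ℂ) 1, ψ z = (√‖V z‖)⁻¹ := fun z hz =>
    DFunLike.congr_fun hψ (⟨z, hz⟩ : closedBall (0 : ℂ) 1)
  refine hasSteinNeighborhoodBasis_closure_hartogsDomain hg hg0 ψ.continuous
    (fun z hz => hψV z hz ▸ inv_pos.2 (hVpos z hz)) fun z hz => ?_
  rw [hψV z (ball_subset_closedBall hz), hVg hz, norm_inv, norm_pow, Real.sqrt_inv,
    Real.sqrt_sq (norm_nonneg _), inv_inv]

end BoundaryRegularity

/-- The Bergman projection of `Ω` maps `C^∞(closure of Ω)` into `W^k(Ω)`: the common consequence of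
the two regularity hypotheses that the theorem uses. -/
def BergmanMapsSmoothToSobolev (Ω : Set (ℂ × ℂ)) (k : ℕ) : Prop :=
  ∀ (F : ℂ × ℂ → ℂ) (f : L2 Ω), MemSmoothBounded Ω F → f =ᵐ[volume.restrict Ω] F →
    MemSobolev Ω k (bergmanProjection Ω f)

lemma BergmanBoundedOnSobolev.mapsSmoothToSobolev {Ω : Set (ℂ × ℂ)} {k : ℕ} (hΩ : IsOpen Ω)
    (hvol : volume Ω ≠ ⊤) (h : BergmanBoundedOnSobolev Ω k) : BergmanMapsSmoothToSobolev Ω k := by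
  obtain ⟨C, hC⟩ := h
  exact fun F f hF hf => (hC f ((hF.memSobolev hΩ hvol k).congr_ae hf.symm)).1

lemma BergmanContinuousOnSmooth.mapsSmoothToSobolev {Ω : Set (ℂ × ℂ)} (hΩ : IsOpen Ω)
    (hvol : volume Ω ≠ ⊤) (h : BergmanContinuousOnSmooth Ω) (k : ℕ) :
    BergmanMapsSmoothToSobolev Ω k := by
  intro F f hF hf
  obtain ⟨B, hB, hfB⟩ := h.1 F f hF hf
  exact (hB.memSobolev hΩ hvol k).congr_ae hfB.symm

theorem theorem1p4_general (g : ℂ → ℂ) (hg : DifferentiableOn ℂ g (ball 0 1))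
    (hnonvan : ∀ z ∈ ball (0 : ℂ) 1, g z ≠ 0) (hbdd : ∃ M : ℝ, ∀ z ∈ ball (0 : ℂ) 1, ‖g z‖ ≤ M)
    (hB : BergmanMapsSmoothToSobolev (hartogsDomain g) 4) :
    HasSteinNeighborhoodBasis (closure (hartogsDomain g)) := by
  obtain ⟨M, hM⟩ := hbdd
  obtain ⟨F, f, hF, hfF, hproj⟩ :=
    exists_memSmoothBounded_bergmanProjection_eq_sndDivSq hg hnonvan (isBounded_hartogsDomain hM)
  have hS : MemSobolev (hartogsDomain g) 4 (sndDivSq g) := (hB F f hF hfF).congr_ae hproj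
  have hsum := summable_norm_iteratedDeriv_div_factorial (differentiableOn_inv_sq hg hnonvan)
    (integrableOn_iteratedDeriv_inv_sq hg hnonvan hS)
  obtain ⟨V, hV, hVg⟩ := exists_continuousOn_closedBall_eqOn_of_summable
    (differentiableOn_inv_sq hg hnonvan) hsum
  exact hasSteinNeighborhoodBasis_of_inv_sq_extension hg hnonvan ⟨M, hM⟩ hV hVg

theorem theorem1p4 (g : ℂ → ℂ)
    (hg : DifferentiableOn ℂ g (Metric.ball 0 1))
    (hnonconst : ¬ ∃ c : ℂ, ∀ z ∈ Metric.ball (0 : ℂ) 1, g z = c)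
    (hnonvan : ∀ z ∈ Metric.ball (0 : ℂ) 1, g z ≠ 0)
    (hbdd : ∃ M : ℝ, ∀ z ∈ Metric.ball (0 : ℂ) 1, ‖g z‖ ≤ M) :
    ((∀ k : ℕ, BergmanBoundedOnSobolev (hartogsDomain g) k) →
      HasSteinNeighborhoodBasis (closure (hartogsDomain g))) ∧
    (BergmanContinuousOnSmooth (hartogsDomain g) →
      HasSteinNeighborhoodBasis (closure (hartogsDomain g))) := by
  have hΩ := isOpen_hartogsDomain hg.continuousOn
  have hvol : volume (hartogsDomain g) ≠ ⊤ :=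
    (isBounded_hartogsDomain hbdd.choose_spec).measure_lt_top.ne
  exact ⟨fun h => theorem1p4_general g hg hnonvan hbdd ((h 4).mapsSmoothToSobolev hΩ hvol),
    fun h => theorem1p4_general g hg hnonvan hbdd (h.mapsSmoothToSobolev hΩ hvol 4)⟩
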